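/- Let $Q$ be the unit disk in $\mathbb{R}^2$, let $k>0$, and let $G_k(x)=-\frac{i}{4}H_0^{(1)}(k|x|)$, where $H_0^{(1)}$ is the Hankel function of the first kind of order zero. For a function $\phi$ on $\partial Q$ let $$(\mathcal{K}_Q^k)^*[\phi](x)=\mathrm{p.v.}\int_{\partial Q}\frac{\partial G_k(x-y)}{\partial\nu(x)}\,\phi(y)\,ds_y ,\qquad x\in\partial Q,$$ where $\nu$ is the exterior unit normal and p.v. denotes the Cauchy principal value. Then for every integer $n\ge 0$ and every $k>0$ there is a unique $\kappa_{n,k}\in\mathbb{C}$ with $(\mathcal{K}_Q^k)^*[e^{in\theta}]=\kappa_{n,k}\,e^{in\theta}$, and the following hold. 1. $\displaystyle\lim_{k\to0^+}\kappa_{0,k}=\tfrac12$, and $\displaystyle\lim_{k\to0^+}\kappa_{n,k}=0$ for every $n\ge1$. 2. For $n$ sufficiently large, $$\kappa_{n,k}=-\frac{k^2}{4n(n-1)(n+1)}+\mathcal{O}\Big(\frac{k^4}{n^4}\Big)$$ uniformly for $k$ small compared with $\sqrt{n+1}$; that is, there are constants $c>0$, $C$ and $N$, independent of $n$ and $k$,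 such that $$\Big|\kappa_{n,k}+\frac{k^2}{4n(n-1)(n+1)}\Big|\le C\,\frac{k^4}{n^4}\qquad\text{for all integers } n\ge N \text{ and all } 0<k\le c\sqrt{n+1}.$$ (In particular, for each fixed $k$ the estimate holds for all sufficiently large $n$, with $C$ independent of $k$.) -/

import Mathlib

open Filter Topology

noncomputable section

/-- The Bessel function of the first kind of order zero (power series, convergent for all `t`). -/
def besselJ0 (t : ℝ) : ℝ :=
  ∑' m : ℕ, (-1 : ℝ) ^ m / ((Nat.factorial m : ℝ) ^ 2) * (t / 2) ^ (2 * m)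

/-- The Bessel function of the second kind (Neumann function) of order zero, for `t > 0`:
`N₀(t) = (2/π) (log (t/2) + γ) J₀(t) - (2/π) ∑ₘ (-1)ᵐ hₘ (t/2)²ᵐ / (m!)²`,
with `hₘ = 1 + 1/2 + ⋯ + 1/m`. -/
def besselN0 (t : ℝ) : ℝ :=
  2 / Real.pi * (Real.log (t / 2) + Real.eulerMascheroniConstant) * besselJ0 t
    - 2 / Real.pi * ∑' m : ℕ,
        (-1 : ℝ) ^ m * (harmonic m : ℝ) / ((Nat.factorial m : ℝ) ^ 2) * (t / 2) ^ (2 * m)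

/-- The Hankel function of the first kind of order zero, `H₀⁽¹⁾ = J₀ + i N₀`, for `t > 0`. -/
def hankelH0 (t : ℝ) : ℂ := (besselJ0 t : ℂ) + Complex.I * (besselN0 t : ℂ)

/-- The outgoing fundamental solution `G_k(x) = -(i/4) H₀⁽¹⁾(k|x|)` of `Δ + k²` in the plane;
`ℝ²` is identified with `ℂ`. -/
def helmholtzG (k : ℝ) (x : ℂ) : ℂ := -(Complex.I / 4) * hankelH0 (k * ‖x‖)

/-- The kernel `∂G_k(x - y)/∂ν(x)` on the boundary of the unit disk: the derivative of
`z ↦ G_k(z - y)` at `x` in the direction of the exterior unit normal, which at the point `x`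
of the unit circle is `x` itself. -/
def npKernel (k : ℝ) (x y : Circle) : ℂ :=
  lineDeriv ℝ (fun z : ℂ => helmholtzG k (z - (y : ℂ))) (x : ℂ) (x : ℂ)

/-- Parameters `θ ∈ (-π, π]` (arc length on the unit circle) of the boundary points at distance
more than `ε` from `x`. -/
def arcAway (x : Circle) (ε : ℝ) : Set ℝ :=
  {θ : ℝ | θ ∈ Set.Ioc (-Real.pi) Real.pi ∧ ε < dist (x : ℂ) (Circle.exp θ : ℂ)}

/-- `I` is the Cauchy principal value at `x` of `∫ f(y) ds_y` over the unit circle. -/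
def HasCirclePV (x : Circle) (f : Circle → ℂ) (I : ℂ) : Prop :=
  (∀ ε : ℝ, 0 < ε →
      MeasureTheory.IntegrableOn (fun θ : ℝ => f (Circle.exp θ)) (arcAway x ε)) ∧
    Tendsto (fun ε : ℝ => ∫ θ in arcAway x ε, f (Circle.exp θ)) (𝓝[>] 0) (𝓝 I)

/-- `(K_Q^k)^*[φ] = ψ` for the Neumann-Poincaré operator of the unit disk `Q`: at every boundary
point the principal value integral of `∂G_k(x - y)/∂ν(x) φ(y)` exists and equals `ψ`. -/
def HasNeumannPoincare (k : ℝ) (φ ψ : Circle → ℂ) : Prop :=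
  ∀ x : Circle, HasCirclePV x (fun y => npKernel k x y * φ y) (ψ x)

/-- The function `e^{inθ}` on the unit circle. -/
def circleMode (n : ℕ) (x : Circle) : ℂ := (x : ℂ) ^ n

theorem circleMode_exp (n : ℕ) (θ : ℝ) :
    circleMode n (Circle.exp θ) = Complex.exp (Complex.I * n * θ) := by
  rw [circleMode, Circle.coe_exp, ← Complex.exp_nat_mul]
  congr 1
  ring

end

noncomputable section

/-! On the unit circle `2⟨x, x - y⟩ = |x - y|²`, so the normal derivative of `G_k(x - y)` is the
Euler operator `u d/du` applied to `G_k` written in `u = (k|x - y|/2)²`. With `|x - y| =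
2|sin(θ/2)|`, `hasSum_npKernel` therefore gives a series in `(k sin(θ/2))^{2m}` whose logarithm
carries a factor `m`. The kernel is bounded, even and a function of the angle alone, so the
principal value is an ordinary convolution, and `κ_{n,k}` is twice the integral of kernel times `cos
nθ` over `[0, π]`.

Integrating termwise expands `κ_{n,k}` in the moments `powCos m n` and `logPowCos m n`.
Multiplication by `sin²(θ/2)` is `-1/4` times the second difference in `n`; hence `powCos m n = 0`
for `m < n`, and `logPowCos m n` has a closed factorial form there (`logPowCos_add`).

The term `m = 0` is independent of `k` and gives the limits at `0`; the others are `O(k)` for `k ≤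
1`. For `n ≥ 2` the term `m = 1` is exactly the stated main term. The rest is `O(k⁴/n⁴)`: for `2 ≤ m
< n` the closed form gives geometric decay when `k² ≤ (n+1)/4`, and for `m ≥ n` the `(m!)²` in the
Bessel coefficients suffices. -/

/-! ### Power series with coefficients bounded by `1/m!` -/

theorem summable_mul_pow_of_abs_le_inv_factorial {a : ℕ → ℝ}
    (ha : ∀ m, |a m| ≤ 1 / (m.factorial : ℝ)) (u : ℝ) : Summable fun m => a m * u ^ m := by
  refine Summable.of_norm_bounded (Real.summable_pow_div_factorial |u|) fun m => ?_
  rw [Real.norm_eq_abs, abs_mul, abs_pow, div_eq_mul_one_div, mul_comm]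
  exact mul_le_mul_of_nonneg_left (ha m) (by positivity)

theorem summable_nat_mul_pow_pred_div_factorial (r : ℝ) :
    Summable fun m : ℕ => (m : ℝ) * r ^ (m - 1) / (m.factorial : ℝ) := by
  rw [← summable_nat_add_iff 1]
  refine (Real.summable_pow_div_factorial r).congr fun m => ?_
  rw [Nat.factorial_succ]
  push_cast
  have : (m.factorial : ℝ) ≠ 0 := by positivity
  have : (m : ℝ) + 1 ≠ 0 := by positivity
  field_simp

/-- Termwise differentiation on a ball containing `u`. The derivative appears multiplied by `u`
because the kernel needs only `u d/du`, which acts diagonally on powers. -/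
theorem exists_hasDerivAt_tsum_mul_pow {a : ℕ → ℝ}
    (ha : ∀ m, |a m| ≤ 1 / (m.factorial : ℝ)) (u : ℝ) :
    ∃ d, HasDerivAt (fun v => ∑' m, a m * v ^ m) d u ∧
      HasSum (fun m : ℕ => m * a m * u ^ m) (u * d) := by
  have hb : ∀ m : ℕ, ∀ y ∈ Metric.ball (0 : ℝ) (|u| + 1), ‖a m * (m * y ^ (m - 1))‖ ≤
      (m : ℝ) * (|u| + 1) ^ (m - 1) / (m.factorial : ℝ) := by
    intro m y hy
    have hy' : |y| ≤ |u| + 1 := by simpa using (Metric.mem_ball.1 hy).le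
    rw [Real.norm_eq_abs, abs_mul, abs_mul, abs_pow, Nat.abs_cast, div_eq_mul_one_div, mul_comm]
    have := ha m
    gcongr
  have hu : u ∈ Metric.ball (0 : ℝ) (|u| + 1) := by simp
  have hs := summable_nat_mul_pow_pred_div_factorial (|u| + 1)
  refine ⟨∑' m : ℕ, a m * (m * u ^ (m - 1)), ?_, ?_⟩
  · exact hasDerivAt_tsum_of_isPreconnected hs Metric.isOpen_ball
      (convex_ball (0 : ℝ) (|u| + 1)).isPreconnected
      (fun m y _ => (hasDerivAt_pow m y).const_mul (a m)) hb hu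
      (summable_mul_pow_of_abs_le_inv_factorial ha u) hu
  · have h1 : Summable fun m : ℕ => a m * (m * u ^ (m - 1)) :=
      Summable.of_norm_bounded hs fun m => hb m u hu
    refine (h1.hasSum.mul_left u).congr_fun fun m => ?_
    rcases m with _ | m
    · simp
    · simp [pow_succ]
      ring

/-- The Taylor coefficients of `J₀(2 √u)`. -/
def besselCoeff (m : ℕ) : ℝ := (-1 : ℝ) ^ m / ((m.factorial : ℝ) ^ 2)

theorem abs_besselCoeff (m : ℕ) : |besselCoeff m| = 1 / ((m.factorial : ℝ) ^ 2) := by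
  rw [besselCoeff, abs_div, abs_pow, abs_neg, abs_one, one_pow, abs_of_nonneg (by positivity)]

theorem harmonic_cast_nonneg (m : ℕ) : (0 : ℝ) ≤ (harmonic m : ℝ) := by
  have : (0 : ℚ) ≤ harmonic m := Finset.sum_nonneg fun _ _ => by positivity
  exact_mod_cast this

theorem harmonic_cast_le (m : ℕ) : (harmonic m : ℝ) ≤ m := by
  have : harmonic m ≤ m := by
    refine (Finset.sum_le_card_nsmul _ _ 1 fun i _ => ?_).trans (by simp)
    exact inv_le_one_of_one_le₀ (by push_cast; linarith [(Nat.cast_nonneg i : (0 : ℚ) ≤ i)])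
  exact_mod_cast this

theorem abs_besselCoeff_le (m : ℕ) : |besselCoeff m| ≤ 1 / (m.factorial : ℝ) := by
  rw [abs_besselCoeff]
  have : (1 : ℝ) ≤ m.factorial := by exact_mod_cast m.factorial_pos
  gcongr
  nlinarith

theorem abs_besselCoeff_mul_harmonic_le (m : ℕ) :
    |besselCoeff m * harmonic m| ≤ 1 / (m.factorial : ℝ) := by
  rw [abs_mul, abs_besselCoeff, abs_of_nonneg (harmonic_cast_nonneg m)]
  have h0 : (0 : ℝ) < m.factorial := by positivity
  have h1 : (harmonic m : ℝ) ≤ m.factorial :=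
    (harmonic_cast_le m).trans (by exact_mod_cast m.self_le_factorial)
  rw [one_div_mul_eq_div, div_le_div_iff₀ (by positivity) h0]
  nlinarith

/-! ### Series expansion of the kernel in the distance -/

/-- The constant part of the bracket in the `m`-th term of the Neumann-Poincaré kernel. -/
def npConst (k : ℝ) (m : ℕ) : ℂ :=
  1 / (4 * Real.pi) - Complex.I * m / 4
    + m / (2 * Real.pi) * ((Real.log k + Real.eulerMascheroniConstant - harmonic m : ℝ) : ℂ)

/-- The `m`-th term of the expansion of the Neumann-Poincaré kernel at distance `2 s`. -/
def npTerm (k : ℝ) (m : ℕ) (s : ℝ) : ℂ :=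
  besselCoeff m * (k * s : ℂ) ^ (2 * m) * (npConst k m + m / (2 * Real.pi) * Real.log s)

/-- `G_k(x)` as a function of `u = (k |x| / 2)²`. -/
def helmholtzProfile (u : ℝ) : ℂ :=
  -(Complex.I / 4) * (((∑' m, besselCoeff m * u ^ m : ℝ) : ℂ) +
    Complex.I * ((2 / Real.pi * (1 / 2 * Real.log u + Real.eulerMascheroniConstant) *
      (∑' m, besselCoeff m * u ^ m)
      - 2 / Real.pi * ∑' m, besselCoeff m * harmonic m * u ^ m : ℝ) : ℂ))

theorem helmholtzG_eq_profile (k : ℝ) (z : ℂ) :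
    helmholtzG k z = helmholtzProfile ((k * ‖z‖ / 2) ^ 2) := by
  have hJ : besselJ0 (k * ‖z‖) = ∑' m, besselCoeff m * ((k * ‖z‖ / 2) ^ 2) ^ m :=
    tsum_congr fun m => by rw [besselCoeff, pow_mul]
  have hN : (∑' m : ℕ, (-1 : ℝ) ^ m * (harmonic m : ℝ) / ((m.factorial : ℝ) ^ 2) *
      (k * ‖z‖ / 2) ^ (2 * m)) = ∑' m, besselCoeff m * harmonic m * ((k * ‖z‖ / 2) ^ 2) ^ m :=
    tsum_congr fun m => by rw [besselCoeff, pow_mul]; ring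
  rw [helmholtzG, hankelH0, besselN0, hN, hJ, helmholtzProfile, Real.log_pow]
  push_cast
  ring

/-- Under `u d/du` the power series gain a factor `m`, while differentiating the logarithm leaves
the `m`-free contribution `1/(4π)`. -/
theorem hasDerivAt_helmholtzProfile {u : ℝ} (hu : 0 < u) :
    ∃ d : ℂ, HasDerivAt helmholtzProfile d u ∧
      HasSum (fun m : ℕ => (besselCoeff m * u ^ m : ℂ) *
        (1 / (4 * Real.pi) - Complex.I * m / 4 + m / (2 * Real.pi) *
          ((1 / 2 * Real.log u + Real.eulerMascheroniConstant - harmonic m : ℝ) : ℂ)))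
        (u * d) := by
  obtain ⟨d₁, hd₁, hs₁⟩ := exists_hasDerivAt_tsum_mul_pow abs_besselCoeff_le u
  obtain ⟨d₂, hd₂, hs₂⟩ := exists_hasDerivAt_tsum_mul_pow abs_besselCoeff_mul_harmonic_le u
  have hs₀ := (summable_mul_pow_of_abs_le_inv_factorial abs_besselCoeff_le u).hasSum
  have hlog := (((Real.hasDerivAt_log hu.ne').const_mul (1 / 2)).add_const
    Real.eulerMascheroniConstant).const_mul (2 / Real.pi)
  have hN := (hlog.mul hd₁).sub (hd₂.const_mul (2 / Real.pi))
  refine ⟨_, (hd₁.ofReal_comp.add (hN.ofReal_comp.const_mul Complex.I)).const_mul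
    (-(Complex.I / 4)), ?_⟩
  have hπ : (Real.pi : ℂ) ≠ 0 := by exact_mod_cast Real.pi_ne_zero
  have hu' : (u : ℂ) ≠ 0 := by exact_mod_cast hu.ne'
  have H := ((Complex.hasSum_ofReal.2 hs₀).mul_left (1 / (4 * Real.pi) : ℂ)).add
    (((Complex.hasSum_ofReal.2 hs₁).mul_left (-(Complex.I / 4) + 1 / (2 * Real.pi) *
      ((1 / 2 * Real.log u + Real.eulerMascheroniConstant : ℝ) : ℂ))).sub
    ((Complex.hasSum_ofReal.2 hs₂).mul_left (1 / (2 * Real.pi) : ℂ)))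
  have e : (u * (-(Complex.I / 4) * ((d₁ : ℂ) + Complex.I *
      ((2 / Real.pi * (1 / 2 * u⁻¹) * ∑' m, besselCoeff m * u ^ m +
        2 / Real.pi * (1 / 2 * Real.log u + Real.eulerMascheroniConstant) * d₁ -
        2 / Real.pi * d₂ : ℝ) : ℂ)))) =
      1 / (4 * Real.pi) * ((∑' m, besselCoeff m * u ^ m : ℝ) : ℂ) +
      ((-(Complex.I / 4) + 1 / (2 * Real.pi) *
        ((1 / 2 * Real.log u + Real.eulerMascheroniConstant : ℝ) : ℂ)) * ((u * d₁ : ℝ) : ℂ) -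
        1 / (2 * Real.pi) * ((u * d₂ : ℝ) : ℂ)) := by
    generalize (∑' m, besselCoeff m * u ^ m) = S
    push_cast
    field_simp
    linear_combination (-4 * (S : ℂ) - 4 * u * d₁ * Real.log u
      - 8 * u * d₁ * Real.eulerMascheroniConstant + 8 * u * d₂) * Complex.I_sq
  refine (e ▸ H).congr_fun fun m => ?_
  push_cast
  field_simp
  ring

theorem hasSum_npKernel {k : ℝ} (hk : 0 < k) {x y : Circle} {s : ℝ} (hs : 0 < s)
    (hxy : ‖(x : ℂ) - y‖ = 2 * s) : HasSum (fun m => npTerm k m s) (npKernel k x y) := by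
  have hu : 0 < (k * s) ^ 2 := by positivity
  obtain ⟨d, hd, hsum⟩ := hasDerivAt_helmholtzProfile hu
  have hx1 : (x : ℂ).re ^ 2 + (x : ℂ).im ^ 2 = 1 := by
    have := Circle.normSq_coe x
    rw [Complex.normSq_apply] at this; nlinarith
  have hy1 : (y : ℂ).re ^ 2 + (y : ℂ).im ^ 2 = 1 := by
    have := Circle.normSq_coe y
    rw [Complex.normSq_apply] at this; nlinarith
  have hn : ∀ z : ℂ, ‖z‖ ^ 2 = z.re ^ 2 + z.im ^ 2 := fun z => by
    rw [Complex.sq_norm, Complex.normSq_apply]; ring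
  have hr : ((x : ℂ).re - (y : ℂ).re) ^ 2 + ((x : ℂ).im - (y : ℂ).im) ^ 2 = 4 * s ^ 2 := by
    have := hn ((x : ℂ) - y)
    rw [hxy] at this; simp at this; linarith
  set U : ℝ → ℝ := fun t => (k * ‖(x : ℂ) + t • (x : ℂ) - y‖ / 2) ^ 2 with hU
  have hU' : U = fun t => k ^ 2 / 4 * (((x : ℂ).re + t * (x : ℂ).re - (y : ℂ).re) ^ 2 +
      ((x : ℂ).im + t * (x : ℂ).im - (y : ℂ).im) ^ 2) := by
    ext t
    have := hn ((x : ℂ) + t • (x : ℂ) - y)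
    simp at this
    simp only [hU, div_pow, mul_pow, Complex.real_smul, this]
    ring
  have hU0 : U 0 = (k * s) ^ 2 := by
    simp only [hU']
    linear_combination k ^ 2 / 4 * hr
  have hUd : HasDerivAt U ((k * s) ^ 2) 0 := by
    rw [hU']
    have h1 : ∀ a b : ℝ, HasDerivAt (fun t : ℝ => (a + t * a - b) ^ 2) (2 * (a - b) * a) 0 := by
      intro a b
      have := ((((hasDerivAt_id (0 : ℝ)).mul_const a).const_add a).sub_const b).pow 2
      refine this.congr_deriv ?_
      simp
    have := ((h1 (x : ℂ).re (y : ℂ).re).add (h1 (x : ℂ).im (y : ℂ).im)).const_mul (k ^ 2 / 4)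
    refine this.congr_deriv ?_
    -- Polarization: `2⟨x, x - y⟩ = |x - y|² + |x|² - |y|²`. Thus `U'(0) = U(0)`, which turns the
    -- chain rule into `u d/du`.
    linear_combination k ^ 2 / 4 * (hr + hx1 - hy1)
  have hker : npKernel k x y = ((k * s) ^ 2 : ℝ) * d := by
    rw [npKernel, lineDeriv]
    have : (fun t : ℝ => helmholtzG k ((x : ℂ) + t • (x : ℂ) - y)) = helmholtzProfile ∘ U := by
      ext t
      rw [helmholtzG_eq_profile]; rfl
    rw [this]
    rw [← hU0] at hd
    rw [(hd.scomp 0 hUd).deriv, Complex.real_smul]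
  rw [hker]
  convert hsum using 2 with m
  rw [Real.log_pow, Real.log_mul hk.ne' hs.ne', npTerm, npConst]
  push_cast
  ring

/-! ### Cosine moments of `sin(θ/2)^{2m}`, with and without a logarithm -/

/-- Half of the `n`-th Fourier cosine coefficient of an even function. -/
def cosCoeff (g : ℝ → ℝ) (n : ℕ) : ℝ := ∫ θ in (0 : ℝ)..Real.pi, g θ * Real.cos (n * θ)

theorem intervalIntegrable_mul_cos {g : ℝ → ℝ}
    (hg : IntervalIntegrable g MeasureTheory.volume 0 Real.pi) (n : ℕ) :
    IntervalIntegrable (fun θ => g θ * Real.cos (n * θ)) MeasureTheory.volume 0 Real.pi :=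
  hg.mul_continuousOn (by fun_prop)

/-- Since `sin²(θ/2) = (1 - cos θ)/2`, the product formula for cosines yields `-1/4` of a second
difference. The shift to `n + 1` keeps all indices natural. -/
theorem cosCoeff_sin_sq_mul {g : ℝ → ℝ}
    (hg : IntervalIntegrable g MeasureTheory.volume 0 Real.pi) (n : ℕ) :
    cosCoeff (fun θ => Real.sin (θ / 2) ^ 2 * g θ) (n + 1) =
      1 / 2 * cosCoeff g (n + 1) - 1 / 4 * (cosCoeff g (n + 2) + cosCoeff g n) := by
  have h := intervalIntegrable_mul_cos hg
  rw [cosCoeff, cosCoeff, cosCoeff, cosCoeff, ← intervalIntegral.integral_add (h _) (h _),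
    ← intervalIntegral.integral_const_mul, ← intervalIntegral.integral_const_mul,
    ← intervalIntegral.integral_sub ((h _).const_mul _) (((h _).add (h _)).const_mul _)]
  refine intervalIntegral.integral_congr fun θ _ => ?_
  have h1 : Real.sin (θ / 2) ^ 2 = 1 / 2 - Real.cos θ / 2 := by
    rw [Real.sin_sq_eq_half_sub]; ring_nf
  have h2 : Real.cos ((n + 2 : ℕ) * θ) =
      Real.cos ((n + 1 : ℕ) * θ) * Real.cos θ - Real.sin ((n + 1 : ℕ) * θ) * Real.sin θ := by
    rw [← Real.cos_add]; push_cast; ring_nf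
  have h3 : Real.cos (n * θ) =
      Real.cos ((n + 1 : ℕ) * θ) * Real.cos θ + Real.sin ((n + 1 : ℕ) * θ) * Real.sin θ := by
    rw [← Real.cos_sub]; push_cast; ring_nf
  simp only [h1, h2, h3]
  ring

theorem integral_cos_nat_mul (n : ℕ) :
    ∫ θ in (0 : ℝ)..Real.pi, Real.cos ((n + 1 : ℕ) * θ) = 0 := by
  rw [intervalIntegral.integral_comp_mul_left Real.cos (by positivity), integral_cos,
    Real.sin_nat_mul_pi]
  simp

theorem sin_nat_mul_eq_sum (n : ℕ) (θ : ℝ) : Real.sin (n * θ) =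
    (∑ j ∈ Finset.range n, 2 * Real.cos ((j + 1 / 2) * θ)) * Real.sin (θ / 2) := by
  induction n with
  | zero => simp
  | succ n ih =>
    rw [Finset.sum_range_succ, add_mul, ← ih, ← sub_eq_iff_eq_add', Real.sin_sub_sin]
    push_cast
    ring_nf

theorem integral_sum_cos_mul_cos_half (n : ℕ) :
    ∫ θ in (0 : ℝ)..Real.pi, (∑ j ∈ Finset.range (n + 1), 2 * Real.cos ((j + 1 / 2) * θ)) *
      Real.cos (θ / 2) = Real.pi := by
  have h : ∀ (j : ℕ) (θ : ℝ), 2 * Real.cos ((j + 1 / 2) * θ) * Real.cos (θ / 2) =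
      Real.cos ((j + 1 : ℕ) * θ) + Real.cos (j * θ) := fun j θ => by
    rw [Real.cos_add_cos]; push_cast; ring_nf
  simp only [Finset.sum_mul, h]
  rw [intervalIntegral.integral_finsetSum fun j _ =>
    Continuous.intervalIntegrable (by fun_prop) _ _, Finset.sum_range_succ']
  have h' : ∀ j : ℕ, ∫ θ in (0 : ℝ)..Real.pi,
      (Real.cos ((j + 1 : ℕ) * θ) + Real.cos (j * θ)) =
      ∫ θ in (0 : ℝ)..Real.pi, Real.cos (j * θ) := fun j => by
    rw [intervalIntegral.integral_add (Continuous.intervalIntegrable (by fun_prop) _ _)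
      (Continuous.intervalIntegrable (by fun_prop) _ _), integral_cos_nat_mul, zero_add]
  simp only [h', integral_cos_nat_mul]
  simp

theorem intervalIntegrable_log_sin_half (a b : ℝ) :
    IntervalIntegrable (fun θ => Real.log (Real.sin (θ / 2))) MeasureTheory.volume a b := by
  have := (intervalIntegrable_log_sin (a := a * 2⁻¹) (b := b * 2⁻¹)).comp_mul_right (c := 2⁻¹)
  simpa [div_eq_mul_inv] using this

/-- Integration by parts: the boundary terms vanish, and `sin((n+1)θ)/sin(θ/2)` is the trigonometric
polynomial `V`, so the remaining integral is elementary. -/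
theorem cosCoeff_log_sin (n : ℕ) :
    cosCoeff (fun θ => Real.log (Real.sin (θ / 2))) (n + 1) = -Real.pi / (2 * (n + 1)) := by
  set V : ℝ → ℝ := fun θ => ∑ j ∈ Finset.range (n + 1), 2 * Real.cos ((j + 1 / 2) * θ) with hV
  have hVc : Continuous V := by fun_prop
  have hs : ∀ θ, Real.sin ((n + 1 : ℕ) * θ) = V θ * Real.sin (θ / 2) := sin_nat_mul_eq_sum (n + 1)
  have hn : (n : ℝ) + 1 ≠ 0 := by positivity
  have hi := intervalIntegrable_mul_cos (intervalIntegrable_log_sin_half 0 Real.pi) (n + 1)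
  have hi2 : IntervalIntegrable (fun θ => V θ * Real.cos (θ / 2) * (1 / (2 * (n + 1))))
    MeasureTheory.volume 0 Real.pi := Continuous.intervalIntegrable (by fun_prop) _ _
  -- The factor `sin(θ/2)` inside `sin((n+1)θ)` tames the logarithm at `θ = 0`, because `s log s` is
  -- continuous.
  have hF : Continuous fun θ =>
      Real.sin ((n + 1 : ℕ) * θ) / (n + 1) * Real.log (Real.sin (θ / 2)) := by
    have : (fun θ => Real.sin ((n + 1 : ℕ) * θ) / (n + 1) * Real.log (Real.sin (θ / 2))) =
        fun θ => V θ / (n + 1) * (Real.sin (θ / 2) * Real.log (Real.sin (θ / 2))) := by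
      ext θ; rw [hs]; ring
    rw [this]
    exact (hVc.div_const _).mul (Real.continuous_mul_log.comp (by fun_prop))
  have hd : ∀ θ ∈ Set.Ioo 0 Real.pi, HasDerivAt
      (fun θ => Real.sin ((n + 1 : ℕ) * θ) / (n + 1) * Real.log (Real.sin (θ / 2)))
      (Real.log (Real.sin (θ / 2)) * Real.cos ((n + 1 : ℕ) * θ) +
        V θ * Real.cos (θ / 2) * (1 / (2 * (n + 1)))) θ := by
    intro θ hθ
    have hpos : 0 < Real.sin (θ / 2) :=
      Real.sin_pos_of_pos_of_lt_pi (by linarith [hθ.1]) (by linarith [hθ.1, hθ.2])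
    have h1 : HasDerivAt (fun θ : ℝ => Real.sin ((n + 1 : ℕ) * θ) / (n + 1))
        (Real.cos ((n + 1 : ℕ) * θ)) θ := by
      have := (((hasDerivAt_id θ).const_mul ((n + 1 : ℕ) : ℝ)).sin).div_const ((n : ℝ) + 1)
      refine this.congr_deriv ?_
      simp only [id]
      push_cast
      field_simp
    have h2 : HasDerivAt (fun θ : ℝ => Real.log (Real.sin (θ / 2)))
        (Real.cos (θ / 2) * (1 / 2) / Real.sin (θ / 2)) θ :=
      (((hasDerivAt_id θ).div_const 2).sin).log hpos.ne'
    refine (h1.mul h2).congr_deriv ?_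
    rw [hs]
    field_simp
  have := intervalIntegral.integral_eq_sub_of_hasDerivAt_of_le Real.pi_pos.le hF.continuousOn hd
    (hi.add hi2)
  rw [intervalIntegral.integral_add hi hi2, intervalIntegral.integral_mul_const,
    integral_sum_cos_mul_cos_half, Real.sin_nat_mul_pi] at this
  rw [cosCoeff]
  simp at this ⊢
  rw [eq_neg_of_add_eq_zero_left this]
  field_simp

/-- `∫₀^π sin(θ/2)^{2m} cos nθ dθ`. -/
def powCos (m n : ℕ) : ℝ := cosCoeff (fun θ => Real.sin (θ / 2) ^ (2 * m)) n

/-- `∫₀^π sin(θ/2)^{2m} log (sin(θ/2)) cos nθ dθ`. -/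
def logPowCos (m n : ℕ) : ℝ :=
  cosCoeff (fun θ => Real.sin (θ / 2) ^ (2 * m) * Real.log (Real.sin (θ / 2))) n

theorem powCos_zero_zero : powCos 0 0 = Real.pi := by simp [powCos, cosCoeff]

theorem powCos_eq_zero {m n : ℕ} (h : m < n) : powCos m n = 0 := by
  induction m generalizing n with
  | zero =>
    obtain ⟨n, rfl⟩ := Nat.exists_eq_add_of_lt h
    simpa [powCos, cosCoeff] using integral_cos_nat_mul n
  | succ m ih =>
    obtain ⟨n, rfl⟩ := Nat.exists_eq_succ_of_ne_zero (Nat.ne_of_gt (Nat.zero_lt_of_lt h))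
    have e : (fun θ => Real.sin (θ / 2) ^ (2 * (m + 1))) =
        fun θ => Real.sin (θ / 2) ^ 2 * Real.sin (θ / 2) ^ (2 * m) := by ext; ring
    rw [powCos, e, Nat.succ_eq_add_one,
      cosCoeff_sin_sq_mul (Continuous.intervalIntegrable (by fun_prop) _ _)]
    have h1 := ih (n := n + 1) (by omega)
    have h2 := ih (n := n + 2) (by omega)
    have h3 := ih (n := n) (by omega)
    simp only [powCos] at h1 h2 h3
    rw [h1, h2, h3]
    norm_num

theorem intervalIntegrable_sin_pow_mul_log (m : ℕ) (a b : ℝ) :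
    IntervalIntegrable (fun θ => Real.sin (θ / 2) ^ (2 * m) * Real.log (Real.sin (θ / 2)))
      MeasureTheory.volume a b :=
  (intervalIntegrable_log_sin_half a b).continuousOn_mul (by fun_prop)

/-- Iterated second differences of the coefficients `-π/(2n)` of the logarithm. With `n = m + 1 + j`
the factorials are `(n-m-1)!` and `(n+m)!`; the range `n > m` is stable, as the step to `m + 1` uses
only `n - 1`, `n`, `n + 1`. -/
theorem logPowCos_add (m j : ℕ) : logPowCos m (m + 1 + j) =
    (-1) ^ (m + 1) * (Real.pi / 2) * ((2 * m).factorial / 4 ^ m) *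
      (j.factorial / (2 * m + 1 + j).factorial) := by
  induction m generalizing j with
  | zero =>
    have h := cosCoeff_log_sin j
    have : logPowCos 0 (0 + 1 + j) = -Real.pi / (2 * (j + 1)) := by
      rw [← h, logPowCos]
      simp [add_comm]
    rw [this]
    rw [show 2 * 0 + 1 + j = j + 1 by omega, Nat.factorial_succ]
    have : (j.factorial : ℝ) ≠ 0 := by positivity
    push_cast
    simp
    field_simp
  | succ m ih =>
    have e : (fun θ => Real.sin (θ / 2) ^ (2 * (m + 1)) * Real.log (Real.sin (θ / 2))) =
        fun θ => Real.sin (θ / 2) ^ 2 *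
          (Real.sin (θ / 2) ^ (2 * m) * Real.log (Real.sin (θ / 2))) := by ext; ring
    have h1 := ih j
    have h2 := ih (j + 1)
    have h3 := ih (j + 2)
    rw [logPowCos, e, show m + 1 + 1 + j = (m + 1 + j) + 1 by omega,
      cosCoeff_sin_sq_mul (intervalIntegrable_sin_pow_mul_log m _ _)]
    simp only [logPowCos] at h1 h2 h3
    rw [show m + 1 + j + 1 = m + 1 + (j + 1) by omega,
      show m + 1 + j + 2 = m + 1 + (j + 2) by omega, h1, h2, h3,
      show 2 * (m + 1) = (2 * m + 1) + 1 by omega,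
      show 2 * m + 1 + 1 + 1 + j = (((2 * m + 1 + j) + 1) + 1) by omega,
      show 2 * m + 1 + (j + 1) = (2 * m + 1 + j) + 1 by omega,
      show 2 * m + 1 + (j + 2) = ((2 * m + 1 + j) + 1) + 1 by omega]
    simp only [Nat.factorial_succ, pow_succ]
    have : (j.factorial : ℝ) ≠ 0 := by positivity
    have : ((2 * m + 1 + j).factorial : ℝ) ≠ 0 := by positivity
    push_cast
    field_simp
    ring

theorem abs_pow_mul_log_le {m : ℕ} (hm : 1 ≤ m) {s : ℝ} (hs : |s| ≤ 1) :
    |s ^ (2 * m) * Real.log s| ≤ 1 := by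
  rcases eq_or_ne s 0 with rfl | h0
  · simp
  have h := (Real.abs_log_mul_self_lt |s| (abs_pos.2 h0) hs).le
  obtain ⟨m, rfl⟩ := Nat.exists_eq_add_of_le' hm
  rw [Real.log_abs, abs_mul, abs_abs] at h
  rw [abs_mul, abs_pow, show 2 * (m + 1) = 2 * m + 1 + 1 by omega, pow_succ, mul_assoc,
    mul_comm |s|]
  exact mul_le_one₀ (pow_le_one₀ (abs_nonneg _) hs) (by positivity) h

theorem abs_cosCoeff_le {g : ℝ → ℝ} (hg : ∀ θ, |g θ| ≤ 1) (n : ℕ) :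
    |cosCoeff g n| ≤ Real.pi := by
  have := intervalIntegral.norm_integral_le_of_norm_le_const (a := 0) (b := Real.pi) (C := 1)
    (f := fun θ => g θ * Real.cos (n * θ)) fun θ _ => by
      rw [norm_mul]
      exact mul_le_one₀ (hg θ) (norm_nonneg _) (Real.abs_cos_le_one _)
  simpa [cosCoeff, abs_of_pos Real.pi_pos] using this

theorem abs_powCos_le (m n : ℕ) : |powCos m n| ≤ Real.pi :=
  abs_cosCoeff_le (fun _ => by
    rw [abs_pow]; exact pow_le_one₀ (abs_nonneg _) (Real.abs_sin_le_one _)) n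

theorem abs_logPowCos_le {m : ℕ} (hm : 1 ≤ m) (n : ℕ) : |logPowCos m n| ≤ Real.pi :=
  abs_cosCoeff_le (fun _ => abs_pow_mul_log_le hm (Real.abs_sin_le_one _)) n

/-! ### Summable majorants for the kernel series -/

theorem summable_pow_mul_pow_div_factorial (p : ℕ) {r : ℝ} (hr : 0 ≤ r) :
    Summable fun m : ℕ => (m : ℝ) ^ p * r ^ m / (m.factorial : ℝ) := by
  refine Summable.of_nonneg_of_le (fun m => by positivity) (fun m => ?_)
    ((Real.summable_pow_div_factorial (Real.exp 1 * r)).mul_left (p.factorial : ℝ))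
  have h := Real.pow_div_factorial_le_exp (x := (m : ℝ)) (by positivity) p
  rw [div_le_iff₀ (by positivity), ← mul_one (m : ℝ), Real.exp_nat_mul, mul_one] at h
  rw [mul_pow, ← mul_div_assoc, ← mul_assoc, mul_comm (p.factorial : ℝ)]
  gcongr

/-- The added `m` pays for the `log s` part of the bracket; the product form separates `k` from `m`.
-/
theorem norm_npConst_add_le (k : ℝ) (m : ℕ) :
    ‖npConst k m‖ + m ≤ (1 + |Real.log k|) * (1 + 4 * (m : ℝ) ^ 2) := by
  have hpi := Real.pi_gt_three
  have h1 : ‖(1 / (4 * Real.pi) : ℂ)‖ ≤ 1 := by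
    simp only [norm_div, norm_mul, Complex.norm_real, Real.norm_eq_abs, abs_of_pos Real.pi_pos]
    norm_num
    have := inv_le_one_of_one_le₀ (by linarith : 1 ≤ Real.pi)
    linarith
  have h2 : ‖(Complex.I * m / 4 : ℂ)‖ ≤ m := by
    simp
    linarith [(Nat.cast_nonneg m : (0 : ℝ) ≤ m)]
  have h3 : ‖(m / (2 * Real.pi) : ℂ)‖ ≤ m := by
    simp only [norm_div, norm_mul, Complex.norm_real, Real.norm_eq_abs, abs_of_pos Real.pi_pos]
    simp
    exact div_le_self (by positivity) (by linarith)
  have h4 : ‖((Real.log k + Real.eulerMascheroniConstant - harmonic m : ℝ) : ℂ)‖ ≤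
      |Real.log k| + 1 + m := by
    rw [Complex.norm_real, Real.norm_eq_abs]
    have a1 := Real.one_half_lt_eulerMascheroniConstant
    have a2 := Real.eulerMascheroniConstant_lt_two_thirds
    have a3 := harmonic_cast_nonneg m
    have a4 := harmonic_cast_le m
    have a5 := neg_abs_le (Real.log k)
    have a6 := le_abs_self (Real.log k)
    rw [abs_le]
    constructor <;> linarith
  have h5 : ‖npConst k m‖ ≤ 1 + m + m * (|Real.log k| + 1 + m) := by
    refine (norm_add_le _ _).trans (add_le_add ((norm_sub_le _ _).trans (add_le_add h1 h2)) ?_)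
    rw [norm_mul]
    exact mul_le_mul h3 h4 (norm_nonneg _) (by positivity)
  have hm : (m : ℝ) ≤ (m : ℝ) ^ 2 := by exact_mod_cast Nat.le_self_pow two_ne_zero m
  nlinarith [abs_nonneg (Real.log k), mul_le_mul_of_nonneg_right hm (abs_nonneg (Real.log k))]

/-- A bound for `npTerm k m` on `[-1, 1]`. -/
def npBound (k : ℝ) (m : ℕ) : ℝ :=
  k ^ (2 * m) / (m.factorial : ℝ) ^ 2 * ((1 + |Real.log k|) * (1 + 4 * (m : ℝ) ^ 2))

theorem npBound_nonneg (k : ℝ) (m : ℕ) : 0 ≤ npBound k m := by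
  rw [npBound, pow_mul]; positivity

theorem summable_npBound (k : ℝ) : Summable (npBound k) := by
  have h := (summable_pow_mul_pow_div_factorial 0 (sq_nonneg k)).add
    ((summable_pow_mul_pow_div_factorial 2 (sq_nonneg k)).mul_left 4)
  refine Summable.of_nonneg_of_le (npBound_nonneg k) (fun m => ?_)
    (h.mul_left (1 + |Real.log k|))
  have h1 : (1 : ℝ) ≤ m.factorial := by exact_mod_cast m.factorial_pos
  have : (k ^ 2) ^ m / (m.factorial : ℝ) ^ 2 ≤ (k ^ 2) ^ m / (m.factorial : ℝ) := by
    gcongr; nlinarith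
  rw [npBound, pow_mul]
  calc _ ≤ (k ^ 2) ^ m / (m.factorial : ℝ) * ((1 + |Real.log k|) * (1 + 4 * (m : ℝ) ^ 2)) := by
        gcongr
    _ = _ := by ring

theorem norm_div_two_pi_mul_le (m : ℕ) (r : ℝ) : ‖(m / (2 * Real.pi) * r : ℂ)‖ ≤ m * |r| := by
  have hpi := Real.pi_gt_three
  rw [norm_mul, Complex.norm_real, Real.norm_eq_abs]
  gcongr
  simp only [norm_div, norm_mul, Complex.norm_real, Real.norm_eq_abs, abs_of_pos Real.pi_pos]
  simp
  exact div_le_self (by positivity) (by linarith)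

theorem npTerm_eq (k : ℝ) (m : ℕ) (s : ℝ) : npTerm k m s =
    ((besselCoeff m * k ^ (2 * m) : ℝ) : ℂ) * (npConst k m * ((s ^ (2 * m) : ℝ) : ℂ) +
      m / (2 * Real.pi) * ((s ^ (2 * m) * Real.log s : ℝ) : ℂ)) := by
  rw [npTerm]
  push_cast
  ring

theorem norm_besselCoeff_mul_pow (k : ℝ) (m : ℕ) :
    ‖((besselCoeff m * k ^ (2 * m) : ℝ) : ℂ)‖ = k ^ (2 * m) / (m.factorial : ℝ) ^ 2 := by
  rw [Complex.norm_real, norm_mul, Real.norm_eq_abs, Real.norm_eq_abs, abs_besselCoeff,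
    abs_of_nonneg (by rw [pow_mul]; positivity : 0 ≤ k ^ (2 * m))]
  ring

theorem norm_npTerm_le (k : ℝ) (m : ℕ) {s : ℝ} (hs : |s| ≤ 1) : ‖npTerm k m s‖ ≤ npBound k m := by
  rw [npTerm_eq, norm_mul, norm_besselCoeff_mul_pow, npBound]
  refine mul_le_mul_of_nonneg_left ?_ (by rw [pow_mul]; positivity)
  refine le_trans ((norm_add_le _ _).trans (add_le_add ?_ ?_)) (norm_npConst_add_le k m)
  · rw [norm_mul, Complex.norm_real, norm_pow]
    exact mul_le_of_le_one_right (norm_nonneg _) (pow_le_one₀ (norm_nonneg _) hs)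
  · refine (norm_div_two_pi_mul_le _ _).trans ?_
    -- For `m = 0` the logarithm is unbounded, but its coefficient vanishes.
    rcases Nat.eq_zero_or_pos m with rfl | hm
    · simp
    · exact mul_le_of_le_one_right (by positivity) (abs_pow_mul_log_le hm hs)

theorem npTerm_neg (k : ℝ) (m : ℕ) (s : ℝ) : npTerm k m (-s) = npTerm k m s := by
  rw [npTerm_eq, npTerm_eq, Real.log_neg_eq_log, (even_two_mul m).neg_pow]

theorem npTerm_abs (k : ℝ) (m : ℕ) (s : ℝ) : npTerm k m |s| = npTerm k m s := by
  rcases abs_choice s with h | h <;> rw [h]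
  exact npTerm_neg k m s

theorem measurable_npTerm (k : ℝ) (m : ℕ) : Measurable (npTerm k m) := by
  unfold npTerm; fun_prop

/-! ### The angular kernel and its eigenvalues -/

/-- The Neumann-Poincaré kernel as a function of the angle between its arguments. -/
def npAngular (k θ : ℝ) : ℂ := ∑' m, npTerm k m (Real.sin (θ / 2))

theorem hasSum_npAngular (k θ : ℝ) :
    HasSum (fun m => npTerm k m (Real.sin (θ / 2))) (npAngular k θ) :=
  (Summable.of_norm_bounded (summable_npBound k)
    fun m => norm_npTerm_le k m (Real.abs_sin_le_one _)).hasSum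

theorem norm_npAngular_le (k θ : ℝ) : ‖npAngular k θ‖ ≤ ∑' m, npBound k m :=
  tsum_of_norm_bounded (summable_npBound k).hasSum
    fun m => norm_npTerm_le k m (Real.abs_sin_le_one _)

theorem measurable_npAngular (k : ℝ) : Measurable (npAngular k) :=
  measurable_of_tendsto_metrizable
    (f := fun N θ => ∑ m ∈ Finset.range N, npTerm k m (Real.sin (θ / 2)))
    (fun N => Finset.measurable_sum _ fun m _ => (measurable_npTerm k m).comp (by fun_prop))
    (tendsto_pi_nhds.2 fun θ => (hasSum_npAngular k θ).tendsto_sum_nat)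

theorem npAngular_neg (k θ : ℝ) : npAngular k (-θ) = npAngular k θ :=
  tsum_congr fun m => by rw [neg_div, Real.sin_neg, npTerm_neg]

theorem npAngular_periodic (k : ℝ) : Function.Periodic (npAngular k) (2 * Real.pi) := fun θ =>
  tsum_congr fun m => by
    rw [add_div, mul_div_cancel_left₀ _ two_ne_zero, Real.sin_add_pi, npTerm_neg]

theorem norm_circleExp_sub (α φ : ℝ) :
    ‖(Circle.exp α : ℂ) - Circle.exp φ‖ = 2 * |Real.sin ((φ - α) / 2)| := by
  have : (Circle.exp α : ℂ) - Circle.exp φ =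
      -(Circle.exp α * (Complex.exp (Complex.I * (φ - α : ℝ)) - 1)) := by
    rw [mul_sub, Circle.coe_exp, Circle.coe_exp, ← Complex.exp_add]
    push_cast
    ring_nf
  rw [this, norm_neg, norm_mul, Circle.norm_coe, one_mul, Complex.norm_exp_I_mul_ofReal_sub_one]
  simp

theorem npKernel_circleExp {k : ℝ} (hk : 0 < k) {α φ : ℝ} (h : Circle.exp α ≠ Circle.exp φ) :
    npKernel k (Circle.exp α) (Circle.exp φ) = npAngular k (φ - α) := by
  have hpos : 0 < |Real.sin ((φ - α) / 2)| := by
    have : 0 < ‖(Circle.exp α : ℂ) - Circle.exp φ‖ :=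
      norm_pos_iff.2 (sub_ne_zero.2 fun e => h (Circle.ext e))
    rw [norm_circleExp_sub] at this
    linarith
  have := hasSum_npKernel hk hpos (norm_circleExp_sub α φ)
  simp only [npTerm_abs] at this
  exact this.unique (hasSum_npAngular k (φ - α))

/-- The eigenvalue `κ_{n,k}`. -/
def npEigenvalue (n : ℕ) (k : ℝ) : ℂ :=
  2 * ∫ θ in (0 : ℝ)..Real.pi, npAngular k θ * Real.cos (n * θ)

theorem intervalIntegrable_npAngular_mul (k : ℝ) {g : ℝ → ℂ} (hg : Continuous g) (a b : ℝ) :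
    IntervalIntegrable (fun θ => npAngular k θ * g θ) MeasureTheory.volume a b := by
  have h : IntervalIntegrable (npAngular k) MeasureTheory.volume a b :=
    (intervalIntegrable_const (c := ∑' m, npBound k m)).mono_fun
      (measurable_npAngular k).aestronglyMeasurable
      (Eventually.of_forall fun θ => (norm_npAngular_le k θ).trans (le_abs_self _))
  exact h.mul_continuousOn hg.continuousOn

/-- Translation factors out the character, periodicity restores the interval, and evenness folds it
onto `[0, π]`, where `e^{inθ} + e^{-inθ} = 2 cos nθ`. -/
theorem integral_npAngular_mul_circleMode (n : ℕ) (k α : ℝ) :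
    ∫ φ in -Real.pi..Real.pi, npAngular k (φ - α) * circleMode n (Circle.exp φ) =
      npEigenvalue n k * circleMode n (Circle.exp α) := by
  have hc : Continuous fun φ : ℝ => circleMode n (Circle.exp φ) := by
    simp only [circleMode]; fun_prop
  have hadd : ∀ θ, circleMode n (Circle.exp (θ + α)) =
      circleMode n (Circle.exp θ) * circleMode n (Circle.exp α) := fun θ => by
    simp only [circleMode, Circle.exp_add, Circle.coe_mul, mul_pow]
  have h1 : ∫ φ in -Real.pi..Real.pi, npAngular k (φ - α) * circleMode n (Circle.exp φ) =
      (∫ θ in (-Real.pi - α)..(Real.pi - α), npAngular k θ * circleMode n (Circle.exp θ)) *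
        circleMode n (Circle.exp α) := by
    rw [← intervalIntegral.integral_mul_const, ← intervalIntegral.integral_comp_sub_right]
    refine intervalIntegral.integral_congr fun φ _ => ?_
    have := hadd (φ - α)
    rw [sub_add_cancel] at this
    simp only [this, mul_assoc]
  have hp : Function.Periodic (fun θ => npAngular k θ * circleMode n (Circle.exp θ))
      (2 * Real.pi) := fun θ => by
    simp only [npAngular_periodic k θ, Circle.exp_add, Circle.exp_two_pi, mul_one]
  have h2 := hp.intervalIntegral_add_eq (-Real.pi - α) (-Real.pi)
  rw [show -Real.pi - α + 2 * Real.pi = Real.pi - α by ring,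
    show -Real.pi + 2 * Real.pi = Real.pi by ring] at h2
  rw [h1, h2]
  congr 1
  have hi := fun a b => intervalIntegrable_npAngular_mul k hc a b
  rw [← intervalIntegral.integral_add_adjacent_intervals (hi (-Real.pi) 0) (hi 0 Real.pi)]
  have h3 := intervalIntegral.integral_comp_neg (a := 0) (b := Real.pi)
    (fun θ => npAngular k θ * circleMode n (Circle.exp θ))
  rw [neg_zero] at h3
  have hc' : Continuous fun φ : ℝ => circleMode n (Circle.exp (-φ)) := hc.comp continuous_neg
  simp only [npAngular_neg] at h3
  rw [← h3, ← intervalIntegral.integral_add (intervalIntegrable_npAngular_mul k hc' _ _)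
    (hi _ _), npEigenvalue, ← intervalIntegral.integral_const_mul]
  refine intervalIntegral.integral_congr fun θ _ => ?_
  simp only [circleMode_exp]
  rw [← mul_add, Complex.ofReal_cos, Complex.cos]
  push_cast
  ring_nf

/-- The kernel agrees off the diagonal with the bounded `npAngular`, so dominated convergence
identifies the principal value with the full integral. -/
theorem hasNeumannPoincare_circleMode (n : ℕ) {k : ℝ} (hk : 0 < k) :
    HasNeumannPoincare k (circleMode n) fun x => npEigenvalue n k * circleMode n x := by
  intro x
  obtain ⟨α, rfl⟩ : ∃ α, Circle.exp α = x := ⟨_, Circle.exp_arg x⟩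
  set H : ℝ → ℂ := fun φ => npAngular k (φ - α) * circleMode n (Circle.exp φ) with hH
  have hc : Continuous fun φ : ℝ => circleMode n (Circle.exp φ) := by
    simp only [circleMode]; fun_prop
  have hHm : Measurable H :=
    ((measurable_npAngular k).comp (measurable_id.sub_const α)).mul hc.measurable
  have hHb : ∀ φ, ‖H φ‖ ≤ ∑' m, npBound k m := fun φ => by
    simp only [hH, circleMode, norm_mul, norm_pow, Circle.norm_coe, one_pow, mul_one]
    exact norm_npAngular_le _ _
  have hIoc : MeasureTheory.IntegrableOn H (Set.Ioc (-Real.pi) Real.pi) :=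
    MeasureTheory.Measure.integrableOn_of_bounded (by simp) hHm.aestronglyMeasurable
      (Eventually.of_forall hHb)
  have hmeas : ∀ ε, MeasurableSet (arcAway (Circle.exp α) ε) := fun ε => by
    have : Continuous fun θ : ℝ => dist (Circle.exp α : ℂ) (Circle.exp θ : ℂ) := by fun_prop
    exact measurableSet_Ioc.inter (measurableSet_lt measurable_const this.measurable)
  have hsub : ∀ ε, arcAway (Circle.exp α) ε ⊆ Set.Ioc (-Real.pi) Real.pi := fun ε θ h => h.1
  have heq : ∀ ε, 0 < ε → Set.EqOn H (fun θ => npKernel k (Circle.exp α) (Circle.exp θ) *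
      circleMode n (Circle.exp θ)) (arcAway (Circle.exp α) ε) := fun ε hε θ hθ => by
    have : Circle.exp α ≠ Circle.exp θ := fun e => by
      have := hθ.2
      rw [e, dist_self] at this
      linarith
    simp only [hH, npKernel_circleExp hk this]
  refine ⟨fun ε hε => (hIoc.mono_set (hsub ε)).congr_fun (heq ε hε) (hmeas ε), ?_⟩
  have hlim : Tendsto (fun ε => ∫ θ, (arcAway (Circle.exp α) ε).indicator H θ) (𝓝[>] 0)
      (𝓝 (∫ θ, (Set.Ioc (-Real.pi) Real.pi).indicator H θ)) := by
    refine MeasureTheory.tendsto_integral_filter_of_dominated_convergence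
      (fun θ => ‖(Set.Ioc (-Real.pi) Real.pi).indicator H θ‖)
      (Eventually.of_forall fun ε => (hHm.indicator (hmeas ε)).aestronglyMeasurable)
      (Eventually.of_forall fun ε => Eventually.of_forall fun θ =>
        norm_indicator_le_of_subset (hsub ε) H θ)
      (hIoc.integrable_indicator measurableSet_Ioc).norm ?_
    -- Pointwise convergence of the indicators can fail only at parameters of `x` itself.
    have hcount : {θ : ℝ | Circle.exp θ = Circle.exp α}.Countable := by
      refine (Set.countable_range fun m : ℤ => α + m * (2 * Real.pi)).mono fun θ hθ => ?_
      obtain ⟨m, hm⟩ := Circle.exp_eq_exp.1 hθ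
      exact ⟨m, hm.symm⟩
    filter_upwards [hcount.ae_notMem MeasureTheory.volume] with θ hθ
    refine tendsto_const_nhds.congr' ?_
    have hd : 0 < dist (Circle.exp α : ℂ) (Circle.exp θ : ℂ) :=
      dist_pos.2 fun e => hθ (Circle.ext e.symm)
    filter_upwards [nhdsWithin_le_nhds (Iio_mem_nhds hd)] with ε hε
    by_cases h : θ ∈ Set.Ioc (-Real.pi) Real.pi
    · rw [Set.indicator_of_mem h, Set.indicator_of_mem (show θ ∈ arcAway _ _ from ⟨h, hε⟩)]
    · rw [Set.indicator_of_notMem h, Set.indicator_of_notMem fun h' => h h'.1]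
  rw [MeasureTheory.integral_indicator measurableSet_Ioc,
    ← intervalIntegral.integral_of_le (by linarith [Real.pi_pos]),
    integral_npAngular_mul_circleMode] at hlim
  refine hlim.congr' ?_
  filter_upwards [self_mem_nhdsWithin] with ε hε
  rw [MeasureTheory.integral_indicator (hmeas ε)]
  exact MeasureTheory.setIntegral_congr_fun (hmeas ε) (heq ε hε)

theorem eq_npEigenvalue {n : ℕ} {k : ℝ} (hk : 0 < k) {μ : ℂ}
    (h : HasNeumannPoincare k (circleMode n) fun x => μ * circleMode n x) :
    μ = npEigenvalue n k := by
  simpa [circleMode] using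
    tendsto_nhds_unique (h 1).2 (hasNeumannPoincare_circleMode n hk 1).2

theorem hasSum_npEigenvalue (n : ℕ) (k : ℝ) :
    HasSum (fun m => 2 * (((besselCoeff m * k ^ (2 * m) : ℝ) : ℂ) *
      (npConst k m * powCos m n + m / (2 * Real.pi) * logPowCos m n))) (npEigenvalue n k) := by
  have h := intervalIntegral.hasSum_integral_of_dominated_convergence
    (μ := MeasureTheory.volume) (a := 0) (b := Real.pi)
    (F := fun m θ => npTerm k m (Real.sin (θ / 2)) * Real.cos (n * θ))
    (f := fun θ => npAngular k θ * Real.cos (n * θ)) (fun m _ => npBound k m)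
    (fun m => (((measurable_npTerm k m).comp (by fun_prop)).mul
      (by fun_prop)).aestronglyMeasurable)
    (fun m => Eventually.of_forall fun θ _ => by
      rw [norm_mul, Complex.norm_real]
      exact (mul_le_of_le_one_right (norm_nonneg _) (Real.abs_cos_le_one _)).trans
        (norm_npTerm_le k m (Real.abs_sin_le_one _)))
    (Eventually.of_forall fun θ _ => summable_npBound k) intervalIntegrable_const
    (Eventually.of_forall fun θ _ => (hasSum_npAngular k θ).mul_right _)
  refine (h.mul_left 2).congr_fun fun m => ?_
  have h1 : IntervalIntegrable
      (fun θ => ((Real.sin (θ / 2) ^ (2 * m) * Real.cos (n * θ) : ℝ) : ℂ))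
      MeasureTheory.volume 0 Real.pi := Continuous.intervalIntegrable (by fun_prop) _ _
  have h2 : IntervalIntegrable (fun θ => ((Real.sin (θ / 2) ^ (2 * m) *
      Real.log (Real.sin (θ / 2)) * Real.cos (n * θ) : ℝ) : ℂ))
      MeasureTheory.volume 0 Real.pi :=
    let h := intervalIntegrable_mul_cos (intervalIntegrable_sin_pow_mul_log m _ _) n
    ⟨h.1.ofReal, h.2.ofReal⟩
  rw [powCos, logPowCos, cosCoeff, cosCoeff, ← intervalIntegral.integral_ofReal,
    ← intervalIntegral.integral_ofReal, ← intervalIntegral.integral_const_mul,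
    ← intervalIntegral.integral_const_mul,
    ← intervalIntegral.integral_add (h1.const_mul _) (h2.const_mul _),
    ← intervalIntegral.integral_const_mul]
  congr 1
  refine intervalIntegral.integral_congr fun θ _ => ?_
  simp only [npTerm_eq]
  push_cast
  ring

/-! ### Expansion of the eigenvalue and the limit `k → 0⁺` -/

/-- The `m`-th term of the expansion of `κ_{n,k}` in powers of `k²`. -/
def npEigenvalueTerm (n : ℕ) (k : ℝ) (m : ℕ) : ℂ :=
  2 * (((besselCoeff m * k ^ (2 * m) : ℝ) : ℂ) *
    (npConst k m * powCos m n + m / (2 * Real.pi) * logPowCos m n))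

theorem norm_npEigenvalueTerm_le (n : ℕ) (k : ℝ) (m : ℕ) :
    ‖npEigenvalueTerm n k m‖ ≤ 8 * npBound k m := by
  have hm : (m : ℝ) * |logPowCos m n| ≤ Real.pi * m := by
    rcases Nat.eq_zero_or_pos m with rfl | hm
    · simp
    · rw [mul_comm]
      gcongr
      exact abs_logPowCos_le hm n
  have h : ‖npConst k m * powCos m n + m / (2 * Real.pi) * logPowCos m n‖ ≤
      4 * ((1 + |Real.log k|) * (1 + 4 * (m : ℝ) ^ 2)) := by
    calc _ ≤ ‖npConst k m‖ * Real.pi + Real.pi * m := by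
          refine (norm_add_le _ _).trans
            (add_le_add ?_ ((norm_div_two_pi_mul_le _ _).trans hm))
          rw [norm_mul, Complex.norm_real]
          gcongr
          exact abs_powCos_le m n
      _ = Real.pi * (‖npConst k m‖ + m) := by ring
      _ ≤ _ := mul_le_mul Real.pi_le_four (norm_npConst_add_le k m) (by positivity) (by norm_num)
  rw [npEigenvalueTerm, norm_mul, norm_mul, norm_besselCoeff_mul_pow, npBound]
  have h0 : 0 ≤ k ^ (2 * m) / (m.factorial : ℝ) ^ 2 := by rw [pow_mul]; positivity
  have := mul_le_mul_of_nonneg_left h h0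
  simp only [Complex.norm_ofNat]
  linarith

theorem npEigenvalueTerm_zero (n : ℕ) (k : ℝ) :
    npEigenvalueTerm n k 0 = powCos 0 n / (2 * Real.pi) := by
  simp [npEigenvalueTerm, npConst, besselCoeff]
  ring

/-- Every term with `m ≥ 1` carries at least `k²(1 + |log k|)`, which is at most `2k` for `k ≤ 1`;
the sum of these terms is thus `O(k)`. -/
theorem tendsto_npEigenvalue (n : ℕ) :
    Tendsto (fun k => npEigenvalue n k) (𝓝[>] 0) (𝓝 (powCos 0 n / (2 * Real.pi))) := by
  have hB : Summable fun m : ℕ => 16 * ((1 + 4 * ((m + 1 : ℕ) : ℝ) ^ 2) / ((m + 1).factorial : ℝ)) := by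
    have h := ((summable_pow_mul_pow_div_factorial 0 zero_le_one).add
      ((summable_pow_mul_pow_div_factorial 2 zero_le_one).mul_left 4)).mul_left 16
    refine ((summable_nat_add_iff 1).2 h).congr fun m => ?_
    push_cast
    ring
  have hle : ∀ k : ℝ, 0 < k → k ≤ 1 → ‖npEigenvalue n k - powCos 0 n / (2 * Real.pi)‖ ≤
      k * ∑' m : ℕ, 16 * ((1 + 4 * ((m + 1 : ℕ) : ℝ) ^ 2) / ((m + 1).factorial : ℝ)) := by
    intro k hk hk1
    have hs := (hasSum_nat_add_iff' 1).2 (hasSum_npEigenvalue n k)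
    rw [Finset.sum_range_one] at hs
    rw [← npEigenvalueTerm_zero n k]
    refine hs.norm_le_of_bounded (hB.hasSum.mul_left k) fun m => ?_
    refine (norm_npEigenvalueTerm_le n k (m + 1)).trans ?_
    have hlog := (Real.abs_log_mul_self_lt k hk hk1).le
    rw [abs_mul, abs_of_pos hk] at hlog
    have hf : (1 : ℝ) ≤ (m + 1).factorial := by exact_mod_cast (m + 1).factorial_pos
    have hkm : k ^ (2 * (m + 1)) ≤ k * k := by
      rw [← pow_two]; exact pow_le_pow_of_le_one hk.le hk1 (by omega)
    have h1 : k ^ (2 * (m + 1)) * (1 + |Real.log k|) ≤ 2 * k := by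
      calc _ ≤ k * k * (1 + |Real.log k|) := by gcongr
        _ = k * (k + |Real.log k| * k) := by ring
        _ ≤ k * (1 + 1) := by gcongr
        _ = 2 * k := by ring
    rw [npBound]
    calc _ = 8 * (k ^ (2 * (m + 1)) * (1 + |Real.log k|)) *
          ((1 + 4 * ((m + 1 : ℕ) : ℝ) ^ 2) / ((m + 1).factorial : ℝ) ^ 2) := by ring
      _ ≤ 8 * (2 * k) * ((1 + 4 * ((m + 1 : ℕ) : ℝ) ^ 2) / ((m + 1).factorial : ℝ)) := by
        gcongr
        nlinarith
      _ = _ := by ring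
  rw [tendsto_iff_norm_sub_tendsto_zero]
  refine tendsto_of_tendsto_of_tendsto_of_le_of_le' tendsto_const_nhds
    (h := fun k : ℝ => k * ∑' m : ℕ, 16 * ((1 + 4 * ((m + 1 : ℕ) : ℝ) ^ 2) /
      ((m + 1).factorial : ℝ))) ?_ (Eventually.of_forall fun k => norm_nonneg _) ?_
  · have : Tendsto (fun k : ℝ => k * ∑' m : ℕ, 16 * ((1 + 4 * ((m + 1 : ℕ) : ℝ) ^ 2) /
      ((m + 1).factorial : ℝ))) (𝓝 0) (𝓝 (0 * _)) := tendsto_id.mul_const _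
    rw [zero_mul] at this
    exact this.mono_left nhdsWithin_le_nhds
  · filter_upwards [self_mem_nhdsWithin, nhdsWithin_le_nhds (Iic_mem_nhds one_pos)] with k h0 h1
    exact hle k h0 h1

/-! ### Main term and remainder for large `n` -/

/-- As `powCos 1 n = 0`, the imaginary part and `log k` drop out, leaving only the logarithmic
moment. -/
theorem npEigenvalueTerm_one {n : ℕ} (hn : 2 ≤ n) (k : ℝ) : npEigenvalueTerm n k 1 =
    ((-(k ^ 2 / (4 * (n : ℝ) * ((n : ℝ) - 1) * ((n : ℝ) + 1))) : ℝ) : ℂ) := by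
  obtain ⟨j, rfl⟩ := Nat.exists_eq_add_of_le hn
  have h := logPowCos_add 1 j
  rw [show 2 * 1 + 1 + j = j + 1 + 1 + 1 by omega, show 1 + 1 + j = 2 + j by omega] at h
  simp only [Nat.factorial_succ] at h
  have hf : (j.factorial : ℝ) ≠ 0 := by positivity
  have h' : logPowCos 1 (2 + j) = Real.pi / (4 * ((j + 1) * (j + 2) * (j + 3))) := by
    rw [h]
    push_cast
    simp
    field_simp
    ring
  have e : npEigenvalueTerm (2 + j) k 1 =
      ((-(k ^ 2 * (logPowCos 1 (2 + j) / Real.pi)) : ℝ) : ℂ) := by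
    simp [npEigenvalueTerm, powCos_eq_zero (show 1 < 2 + j by omega), besselCoeff]
    field_simp
  rw [e, h']
  congr 2
  have hj : (2 + j : ℝ) - 1 = j + 1 := by ring
  push_cast
  rw [hj]
  field_simp
  ring

/-- With `m = 2 + i` and `n = 3 + i + j` this is `n⁴ (n+1)^{m-2} (n-m-1)! ≤ (n+m)!`. Trading `j + 1`
for `i + 1` keeps `n` fixed and adds one top factor, at least `n + 1`, and one bottom factor, at
least `1`. -/
theorem pow_four_mul_pow_mul_factorial_le (i j : ℕ) :
    (3 + i + j) ^ 4 * (4 + i + j) ^ i * j.factorial ≤ (5 + 2 * i + j).factorial := by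
  induction i generalizing j with
  | zero =>
    rw [show 5 + 2 * 0 + j = j + 1 + 1 + 1 + 1 + 1 by omega]
    simp only [Nat.factorial_succ, pow_zero, mul_one, ← mul_assoc]
    gcongr
    nlinarith [Nat.zero_le (j ^ 5), Nat.zero_le (j ^ 4), Nat.zero_le (j ^ 3), Nat.zero_le (j ^ 2)]
  | succ i ih =>
    have h := ih (j + 1)
    rw [Nat.factorial_succ] at h
    rw [show 5 + 2 * (i + 1) + j = (5 + 2 * i + (j + 1)) + 1 by omega, Nat.factorial_succ]
    calc (3 + (i + 1) + j) ^ 4 * (4 + (i + 1) + j) ^ (i + 1) * j.factorial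
        = (4 + (i + 1) + j) *
          ((3 + i + (j + 1)) ^ 4 * (4 + i + (j + 1)) ^ i * (1 * j.factorial)) := by
          rw [pow_succ]; ring
      _ ≤ (5 + 2 * i + (j + 1) + 1) *
          ((3 + i + (j + 1)) ^ 4 * (4 + i + (j + 1)) ^ i * ((j + 1) * j.factorial)) :=
          Nat.mul_le_mul (by omega)
            (Nat.mul_le_mul_left _ (Nat.mul_le_mul_right _ (by omega)))
      _ ≤ _ := by gcongr

theorem factorial_two_mul_div_four_pow_le (m : ℕ) :
    ((2 * m).factorial : ℝ) / 4 ^ m ≤ (m.factorial : ℝ) ^ 2 := by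
  rw [div_le_iff₀ (by positivity)]
  have h := Nat.centralBinom_le_four_pow m
  have h2 := Nat.choose_mul_factorial_mul_factorial (show m ≤ 2 * m by omega)
  rw [show 2 * m - m = m by omega, ← Nat.centralBinom_eq_two_mul_choose] at h2
  have : (2 * m).factorial ≤ m.factorial ^ 2 * 4 ^ m := by
    rw [← h2, mul_assoc, mul_comm, pow_two]
    gcongr
  exact_mod_cast this

/-- Only the logarithmic moment survives. Its `(2m)!/4^m` cancels against `(m!)²`, and its
`(n+1)^{-(m-2)}` against `(k²)^{m-2}`, leaving powers of `1/4`. -/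
theorem norm_npEigenvalueTerm_le_of_lt {n m : ℕ} {k : ℝ} (hm : 2 ≤ m) (hmn : m < n)
    (hk : k ^ 2 ≤ ((n : ℝ) + 1) / 4) :
    ‖npEigenvalueTerm n k m‖ ≤ k ^ 4 / (n : ℝ) ^ 4 * (64 * (m * (1 / 4) ^ m)) := by
  obtain ⟨i, rfl⟩ := Nat.exists_eq_add_of_le hm
  obtain ⟨j, rfl⟩ := Nat.exists_eq_add_of_le (show 2 + i + 1 ≤ n by omega)
  set n := 2 + i + 1 + j with hn
  have hn0 : (0 : ℝ) < n := by positivity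
  have hE : (j.factorial : ℝ) / ((2 * (2 + i) + 1 + j).factorial : ℝ) ≤
      1 / ((n : ℝ) ^ 4 * (n + 1) ^ i) := by
    have h := pow_four_mul_pow_mul_factorial_le i j
    rw [show 3 + i + j = n by omega, show 4 + i + j = n + 1 by omega,
      show 5 + 2 * i + j = 2 * (2 + i) + 1 + j by omega] at h
    rw [div_le_div_iff₀ (by positivity) (by positivity), one_mul, mul_comm]
    exact_mod_cast h
  have hL : |logPowCos (2 + i) n| ≤ 2 * (((2 + i).factorial : ℝ) ^ 2) *
      (1 / ((n : ℝ) ^ 4 * (n + 1) ^ i)) := by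
    rw [logPowCos_add, abs_mul, abs_mul, abs_mul, abs_pow, abs_neg, abs_one, one_pow, one_mul,
      abs_of_pos (by positivity), abs_of_nonneg (by positivity), abs_of_nonneg (by positivity)]
    have := factorial_two_mul_div_four_pow_le (2 + i)
    have hpi : Real.pi / 2 ≤ 2 := by linarith [Real.pi_le_four]
    gcongr
  have hkk : (k ^ 2) ^ i ≤ (((n : ℝ) + 1) / 4) ^ i := pow_le_pow_left₀ (sq_nonneg k) hk i
  rw [npEigenvalueTerm, powCos_eq_zero hmn, Complex.ofReal_zero, mul_zero, zero_add, norm_mul,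
    norm_mul, norm_besselCoeff_mul_pow, Complex.norm_ofNat]
  have hL' := (norm_div_two_pi_mul_le (2 + i) (logPowCos (2 + i) n)).trans
    (mul_le_mul_of_nonneg_left hL (by positivity))
  have hf : ((2 + i).factorial : ℝ) ≠ 0 := by positivity
  rw [show k ^ (2 * (2 + i)) = k ^ 4 * (k ^ 2) ^ i by rw [pow_mul, pow_add]; ring]
  calc _ ≤ 2 * (k ^ 4 * (((n : ℝ) + 1) / 4) ^ i / ((2 + i).factorial : ℝ) ^ 2 *
        (((2 + i : ℕ) : ℝ) * (2 * (((2 + i).factorial : ℝ) ^ 2) *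
          (1 / ((n : ℝ) ^ 4 * (n + 1) ^ i))))) := by gcongr
    _ = k ^ 4 / (n : ℝ) ^ 4 * (4 * (((2 + i : ℕ) : ℝ) * (1 / 4) ^ i)) := by
      rw [div_pow, div_pow]
      field_simp
      ring
    _ = k ^ 4 / (n : ℝ) ^ 4 * (64 * (((2 + i : ℕ) : ℝ) * (1 / 4) ^ (2 + i))) := by
      rw [pow_add]; ring

theorem sq_mul_one_add_abs_log_le {k : ℝ} (hk : 0 < k) :
    k ^ 2 * (1 + |Real.log k|) ≤ 1 + k ^ 2 + (k ^ 2) ^ 2 := by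
  rcases le_total k 1 with h | h
  · have hlog := (Real.abs_log_mul_self_lt k hk h).le
    rw [abs_mul, abs_of_pos hk] at hlog
    nlinarith [abs_nonneg (Real.log k), sq_nonneg (k ^ 2)]
  · have := Real.log_le_sub_one_of_pos hk
    rw [abs_of_nonneg (Real.log_nonneg h)]
    have : Real.log k ≤ k ^ 2 := by nlinarith
    nlinarith [mul_le_mul_of_nonneg_left this (sq_nonneg k)]

/-- From `(m+1)^m / m! ≤ e^{m+1}` and `e ≤ 3 < 4`. -/
theorem pow_div_factorial_le_three {n m : ℕ} (hmn : n ≤ m) :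
    (((n : ℝ) + 1) / 4) ^ m / (m.factorial : ℝ) ≤ 3 := by
  have h := Real.pow_div_factorial_le_exp (x := (m : ℝ) + 1) (by positivity) m
  have he : Real.exp ((m : ℝ) + 1) ≤ 3 * 4 ^ m := by
    have h1 : Real.exp 1 ≤ 3 := by linarith [Real.exp_one_lt_d9]
    rw [Real.exp_add, ← mul_one (m : ℝ), Real.exp_nat_mul, mul_comm]
    gcongr
    linarith
  have hn : (n : ℝ) ≤ m := by exact_mod_cast hmn
  calc _ ≤ (((m : ℝ) + 1) / 4) ^ m / (m.factorial : ℝ) := by gcongr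
    _ = ((m : ℝ) + 1) ^ m / (m.factorial : ℝ) / 4 ^ m := by rw [div_pow]; ring
    _ ≤ 3 * 4 ^ m / 4 ^ m := by gcongr; exact h.trans he
    _ = 3 := by field_simp

/-- One `m!` absorbs `((n+1)/4)^m`; the other keeps the series summable after `1/n⁴` is created from
`1 ≤ m⁴/n⁴`. -/
theorem norm_npEigenvalueTerm_le_of_ge {n m : ℕ} {k : ℝ} (hn : 3 ≤ n) (hmn : n ≤ m) (hk0 : 0 < k)
    (hk : k ^ 2 ≤ ((n : ℝ) + 1) / 4) : ‖npEigenvalueTerm n k m‖ ≤ k ^ 4 / (n : ℝ) ^ 4 *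
      (72 * (((m : ℝ) ^ 4 + 4 * (m : ℝ) ^ 6) / (m.factorial : ℝ))) := by
  refine (norm_npEigenvalueTerm_le n k m).trans ?_
  have hn3 : (3 : ℝ) ≤ n := by exact_mod_cast hn
  have hnm : (n : ℝ) ≤ m := by exact_mod_cast hmn
  have hf : (0 : ℝ) < m.factorial := by positivity
  have h3 := pow_div_factorial_le_three hmn
  set R := ((n : ℝ) + 1) / 4 with hR
  have hR1 : 1 ≤ R := by linarith
  have hpow : k ^ (2 * m) * (1 + |Real.log k|) ≤ 3 * k ^ 4 * R ^ m := by
    -- Of the `m` factors `k²`, two are kept as `k⁴` and a third absorbs `log k`.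
    obtain ⟨i, rfl⟩ := Nat.exists_eq_add_of_le (show 3 ≤ m by omega)
    have h1 : k ^ 2 * (1 + |Real.log k|) ≤ 3 * R ^ 3 := by
      refine (sq_mul_one_add_abs_log_le hk0).trans ?_
      have := pow_le_pow_left₀ (sq_nonneg k) hk 2
      nlinarith [pow_le_pow_right₀ hR1 (show 2 ≤ 3 by norm_num),
        pow_le_pow_right₀ hR1 (show 1 ≤ 3 by norm_num), one_le_pow₀ hR1 (n := 3)]
    calc _ = k ^ 4 * (k ^ 2) ^ i * (k ^ 2 * (1 + |Real.log k|)) := by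
          rw [pow_mul, pow_add]; ring
      _ ≤ k ^ 4 * R ^ i * (3 * R ^ 3) := by gcongr
      _ = _ := by rw [pow_add]; ring
  have hm4 : 1 ≤ (m : ℝ) ^ 4 / (n : ℝ) ^ 4 := by
    rw [one_le_div (by positivity)]
    gcongr
  rw [npBound]
  calc _ = 8 * (k ^ (2 * m) * (1 + |Real.log k|) / (m.factorial : ℝ)) *
        ((1 + 4 * (m : ℝ) ^ 2) / (m.factorial : ℝ)) := by ring
    _ ≤ 8 * (3 * k ^ 4 * R ^ m / (m.factorial : ℝ)) *
        ((1 + 4 * (m : ℝ) ^ 2) / (m.factorial : ℝ)) := by gcongr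
    _ = 24 * k ^ 4 * (R ^ m / (m.factorial : ℝ)) *
        ((1 + 4 * (m : ℝ) ^ 2) / (m.factorial : ℝ)) * 1 := by ring
    _ ≤ 24 * k ^ 4 * 3 * ((1 + 4 * (m : ℝ) ^ 2) / (m.factorial : ℝ)) *
        ((m : ℝ) ^ 4 / (n : ℝ) ^ 4) := by gcongr
    _ = _ := by ring

/-- A summable bound for the terms of order at least two of the expansion of `κ_{n,k}`, up to
the factor `k⁴ / n⁴`. -/
def remainderBound (m : ℕ) : ℝ :=
  64 * (m * (1 / 4) ^ m) + 72 * (((m : ℝ) ^ 4 + 4 * (m : ℝ) ^ 6) / (m.factorial : ℝ))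

theorem summable_remainderBound : Summable remainderBound := by
  have h1 : Summable fun m : ℕ => (m : ℝ) * (1 / 4) ^ m := by
    simpa using summable_pow_mul_geometric_of_norm_lt_one 1 (r := (1 / 4 : ℝ)) (by norm_num)
  have h2 : Summable fun m : ℕ => ((m : ℝ) ^ 4 + 4 * (m : ℝ) ^ 6) / (m.factorial : ℝ) :=
    ((summable_pow_mul_pow_div_factorial 4 zero_le_one).add
      ((summable_pow_mul_pow_div_factorial 6 zero_le_one).mul_left 4)).congr fun m => by ring
  exact (h1.mul_left 64).add (h2.mul_left 72)

theorem norm_npEigenvalue_sub_le {n : ℕ} {k : ℝ} (hn : 3 ≤ n) (hk0 : 0 < k)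
    (hk : k ^ 2 ≤ ((n : ℝ) + 1) / 4) :
    ‖npEigenvalue n k -
      ((-(k ^ 2 / (4 * (n : ℝ) * ((n : ℝ) - 1) * ((n : ℝ) + 1))) : ℝ) : ℂ)‖ ≤
      k ^ 4 / (n : ℝ) ^ 4 * ∑' m, remainderBound (m + 2) := by
  have hs : HasSum (fun m => npEigenvalueTerm n k (m + 2))
      (npEigenvalue n k - ∑ m ∈ Finset.range 2, npEigenvalueTerm n k m) :=
    (hasSum_nat_add_iff' 2).2 (hasSum_npEigenvalue n k)
  rw [Finset.sum_range_succ, Finset.sum_range_one, npEigenvalueTerm_zero,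
    powCos_eq_zero (by omega), npEigenvalueTerm_one (by omega), Complex.ofReal_zero, zero_div,
    zero_add] at hs
  have hB := (summable_nat_add_iff 2).2 summable_remainderBound
  refine hs.norm_le_of_bounded (hB.hasSum.mul_left _) fun m => ?_
  rcases lt_or_ge (m + 2) n with h | h
  · refine (norm_npEigenvalueTerm_le_of_lt (by omega) h hk).trans ?_
    exact mul_le_mul_of_nonneg_left (le_add_of_nonneg_right (by positivity)) (by positivity)
  · refine (norm_npEigenvalueTerm_le_of_ge hn h hk0 hk).trans ?_
    exact mul_le_mul_of_nonneg_left (le_add_of_nonneg_left (by positivity)) (by positivity)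

end

theorem theorem4p3 :
    (∀ (n : ℕ) (k : ℝ), 0 < k →
      ∃! μ : ℂ, HasNeumannPoincare k (circleMode n) (fun x => μ * circleMode n x)) ∧
    ∀ κ : ℕ → ℝ → ℂ,
      (∀ (n : ℕ) (k : ℝ), 0 < k →
        HasNeumannPoincare k (circleMode n) (fun x => κ n k * circleMode n x)) →
      Tendsto (fun k : ℝ => κ 0 k) (𝓝[>] 0) (𝓝 (1 / 2)) ∧
      (∀ n : ℕ, 1 ≤ n → Tendsto (fun k : ℝ => κ n k) (𝓝[>] 0) (𝓝 0)) ∧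
      ∃ c : ℝ, 0 < c ∧ ∃ (C : ℝ) (N : ℕ), ∀ n : ℕ, N ≤ n → ∀ k : ℝ, 0 < k →
        k ≤ c * Real.sqrt ((n : ℝ) + 1) →
        ‖κ n k - ((-(k ^ 2 / (4 * (n : ℝ) * ((n : ℝ) - 1) * ((n : ℝ) + 1))) : ℝ) : ℂ)‖
          ≤ C * (k ^ 4 / (n : ℝ) ^ 4) := by
  refine ⟨fun n k hk => ⟨_, hasNeumannPoincare_circleMode n hk, fun μ hμ =>
    eq_npEigenvalue hk hμ⟩, fun κ hκ => ?_⟩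
  have hev : ∀ n : ℕ, npEigenvalue n =ᶠ[𝓝[>] 0] fun k => κ n k := fun n => by
    filter_upwards [self_mem_nhdsWithin] with k hk
    exact (eq_npEigenvalue hk (hκ n k hk)).symm
  -- `c = 1/2` yields `k² ≤ (n+1)/4`, the source of the ratio `1/4`; `N = 3` makes `(n+1)/4 ≥ 1` and
  -- leaves three factors `k²` in the tail.
  refine ⟨?_, fun n hn => ?_, 1 / 2, by norm_num, ∑' m, remainderBound (m + 2), 3,
    fun n hn k hk hkn => ?_⟩
  · have h := (tendsto_npEigenvalue 0).congr' (hev 0)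
    have hπ : (Real.pi : ℂ) ≠ 0 := by exact_mod_cast Real.pi_ne_zero
    rwa [powCos_zero_zero, show (Real.pi / (2 * Real.pi) : ℂ) = 1 / 2 by field_simp] at h
  · have h := (tendsto_npEigenvalue n).congr' (hev n)
    rwa [powCos_eq_zero hn, Complex.ofReal_zero, zero_div] at h
  · have hk2 : k ^ 2 ≤ ((n : ℝ) + 1) / 4 := by
      have := pow_le_pow_left₀ hk.le hkn 2
      rw [mul_pow, Real.sq_sqrt (by positivity)] at this
      linarith
    rw [eq_npEigenvalue hk (hκ n k hk)]
    exact (norm_npEigenvalue_sub_le hn hk hk2).trans_eq (mul_comm _ _)
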